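/- Let $S_n$ be the symmetric group on $\{1,\dots,n\}$ with simple reflections $s_i=(i\ \ i+1)$, $1\le i\le n-1$. The Iwahori--Hecke algebra $\mathcal H$ of $S_n$ is the associative unital $\mathbb Z[\xi]$-algebra ($\xi$ an indeterminate) with generators $\tilde T_{s_1},\dots,\tilde T_{s_{n-1}}$ and relations $\tilde T_{s_i}\tilde T_{s_j}=\tilde T_{s_j}\tilde T_{s_i}$ for $|i-j|\ge 2$, $\tilde T_{s_i}\tilde T_{s_{i+1}}\tilde T_{s_i}=\tilde T_{s_{i+1}}\tilde T_{s_i}\tilde T_{s_{i+1}}$ for $1\le i\le n-2$, and $\tilde T_{s_i}^2=1+\xi\tilde T_{s_i}$. For a reduced expression $w=s_{i_1}\cdots s_{i_r}$ put $\tilde T_w=\tilde T_{s_{i_1}}\cdots\tilde T_{s_{i_r}}$; the elements $\tilde T_w$, $w\in S_n$, form a $\mathbb Z[\xi]$-basis of $\mathcal H$, and $f_{xyz}$ denotes the coefficient of $\tilde T_z$ in $\tilde T_x\tilde T_y$. Fix $k\in\{1,\dots,n-1\}$. For $w\in S_n$ let $\#(w)$ be the minimal number of occurrences of $s_k$ in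 a reduced expression for $w$. For $0\le m\le\min\{k,n-k\}$ let $$d_m=(k\ \ k+m)(k-1\ \ k+m-1)\cdots(k+1-m\ \ k+1),$$ let $S_{(k,n-k)}$ be the subgroup generated by the $s_i$ with $i\ne k$, and let $P_m=S_{(k,n-k)}\cap d_m^{-1}S_{(k,n-k)}d_m$. (1) There are $f_w\in\mathbb N[\xi]$ $(w\in S_n)$ with $$(\tilde T_{d_m})^2=\tilde T_1+\sum_{w\in S_n}f_w\tilde T_w,$$ such that $\#(w)\ge 1$ whenever $f_w\ne 0$, and $f_w=f_{d_md_mw}$ for all $w\neq 1$. (2) Consequently, for every $v\in P_m$ there are $g_w\in\mathbb N[\xi]$ $(w\in S_n)$ with $$\tilde T_{d_m}\tilde T_v\tilde T_{d_m}=\tilde T_{d_mvd_m}+\sum_{w\in S_n}g_w\tilde T_w,$$ such that $\#(w)\ge 1$ whenever $g_w\ne 0$. -/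

import Mathlib

open Polynomial

namespace HeckeSym

/-- The indices `1, …, n - 1` of the simple reflections of the symmetric group on `n` letters. -/
abbrev Idx (n : ℕ) : Type := {i : ℕ // 1 ≤ i ∧ i < n}

/-- The letter `a ∈ {1, …, n}` as an element of `Fin n` (which counts from `0`). -/
def letter {n : ℕ} (a : ℕ) (h : 1 ≤ a ∧ a ≤ n) : Fin n := ⟨a - 1, by omega⟩

/-- The simple reflection `s_i = (i  i+1)`. -/
def simple {n : ℕ} (i : Idx n) : Equiv.Perm (Fin n) :=
  Equiv.swap (letter i.1 ⟨i.2.1, i.2.2.le⟩) (letter (i.1 + 1) ⟨by omega, i.2.2⟩)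

/-- The element `s_{i_1} ⋯ s_{i_r}` expressed by the word `(i_1, …, i_r)`. -/
def wordProd {n : ℕ} (l : List (Idx n)) : Equiv.Perm (Fin n) := (l.map simple).prod

/-- A word is reduced if no word with fewer letters expresses the same element. -/
def IsReduced {n : ℕ} (l : List (Idx n)) : Prop :=
  ∀ l' : List (Idx n), wordProd l' = wordProd l → l.length ≤ l'.length

/-! ### Ascents and inversions: every element has a reduced word -/

/-- `s_i w` is longer than `w`. -/
def Asc {n : ℕ} (i : Idx n) (w : Equiv.Perm (Fin n)) : Prop :=
  w⁻¹ (letter i.1 ⟨i.2.1, i.2.2.le⟩) < w⁻¹ (letter (i.1 + 1) ⟨by omega, i.2.2⟩)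

/-- The set of inversions of `w`. -/
def invSet {n : ℕ} (w : Equiv.Perm (Fin n)) : Finset (Fin n × Fin n) :=
  {p | p.1 < p.2 ∧ w p.2 < w p.1}

theorem mem_invSet {n : ℕ} (w : Equiv.Perm (Fin n)) (p : Fin n × Fin n) :
    p ∈ invSet w ↔ p.1.1 < p.2.1 ∧ (w p.2).1 < (w p.1).1 := by
  simp [invSet]

theorem invSet_one {n : ℕ} : invSet (1 : Equiv.Perm (Fin n)) = ∅ := by
  ext p
  rw [mem_invSet, Equiv.Perm.one_apply, Equiv.Perm.one_apply]
  simp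
  omega

theorem simple_mul_self {n : ℕ} (i : Idx n) : simple i * simple i = 1 :=
  Equiv.swap_mul_self _ _

theorem simple_mul_cancel {n : ℕ} (i : Idx n) (w : Equiv.Perm (Fin n)) :
    simple i * (simple i * w) = w := by
  rw [← mul_assoc, simple_mul_self, one_mul]

theorem simple_val {n : ℕ} (i : Idx n) (x : Fin n) :
    (simple i x).1 = if x.1 + 1 = i.1 then i.1 else if x.1 = i.1 then i.1 - 1 else x.1 := by
  have := i.2
  simp only [simple, letter, Equiv.swap_apply_def, Fin.ext_iff]
  split_ifs <;> simp at * <;> omega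

theorem simple_inv {n : ℕ} (i : Idx n) : (simple i)⁻¹ = simple i := Equiv.swap_inv _ _

theorem simple_comm {n : ℕ} (i j : Idx n) (h : i.1 + 2 ≤ j.1 ∨ j.1 + 2 ≤ i.1) :
    simple i * simple j = simple j * simple i := by
  ext x
  have := i.2; have := j.2
  simp only [Equiv.Perm.mul_apply, simple_val]
  split_ifs <;> omega

theorem simple_braid {n : ℕ} (i j : Idx n) (h : j.1 = i.1 + 1) :
    simple i * simple j * simple i = simple j * simple i * simple j := by
  obtain ⟨i, hi⟩ := i
  obtain ⟨j, hj⟩ := j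
  subst h
  simp only [simple]
  rw [Equiv.swap_comm (letter i _), Equiv.swap_comm (letter (i + 1) _) (letter (i + 1 + 1) _),
    Equiv.swap_mul_swap_mul_swap, Equiv.swap_comm (letter (i + 1) _) (letter i _),
    Equiv.swap_comm (letter (i + 1 + 1) _) (letter (i + 1) _),
    Equiv.swap_mul_swap_mul_swap, Equiv.swap_comm]
  all_goals simp [letter]
  all_goals omega

theorem asc_simple_mul {n : ℕ} (i : Idx n) (w : Equiv.Perm (Fin n)) :
    Asc i (simple i * w) ↔ ¬ Asc i w := by
  simp only [Asc, mul_inv_rev, simple_inv, Equiv.Perm.mul_apply]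
  simp only [simple, Equiv.swap_apply_left, Equiv.swap_apply_right, not_lt]
  refine ⟨le_of_lt, fun h => lt_of_le_of_ne h fun h' => ?_⟩
  have := i.2
  simp [letter] at h'
  omega

theorem card_invSet_of_asc {n : ℕ} {i : Idx n} {w : Equiv.Perm (Fin n)} (h : Asc i w) :
    (invSet (simple i * w)).card = (invSet w).card + 1 := by
  set p := w⁻¹ (letter i.1 ⟨i.2.1, i.2.2.le⟩) with hp
  set q := w⁻¹ (letter (i.1 + 1) ⟨by omega, i.2.2⟩) with hq
  have hi := i.2
  have hwp : (w p).1 = i.1 - 1 := by simp [hp, letter]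
  have hwq : (w q).1 = i.1 := by simp [hq, letter]
  have hlt : p < q := h
  have hnot : (p, q) ∉ invSet w := by
    rw [mem_invSet]
    simp only
    omega
  rw [← Finset.card_insert_of_notMem hnot]
  congr 1
  ext ⟨x, y⟩
  simp only [mem_invSet, Finset.mem_insert, Prod.mk.injEq, Equiv.Perm.mul_apply]
  have hx : x = p ↔ (w x).1 = i.1 - 1 := by
    rw [← w.injective.eq_iff, Fin.ext_iff, hwp]
  have hy : y = q ↔ (w y).1 = i.1 := by
    rw [← w.injective.eq_iff, Fin.ext_iff, hwq]
  have hx' : x = q ↔ (w x).1 = i.1 := by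
    rw [← w.injective.eq_iff, Fin.ext_iff, hwq]
  have hy' : y = p ↔ (w y).1 = i.1 - 1 := by
    rw [← w.injective.eq_iff, Fin.ext_iff, hwp]
  have hxy : x = y ↔ (w x).1 = (w y).1 := by
    rw [← w.injective.eq_iff, Fin.ext_iff]
  rw [Fin.lt_def] at hlt
  simp only [simple_val]
  simp only [Fin.ext_iff] at hx hy hx' hy' hxy ⊢
  split_ifs <;> omega

theorem card_invSet_of_not_asc {n : ℕ} {i : Idx n} {w : Equiv.Perm (Fin n)} (h : ¬ Asc i w) :
    (invSet (simple i * w)).card + 1 = (invSet w).card := by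
  have := card_invSet_of_asc ((asc_simple_mul i w).2 h)
  rw [simple_mul_cancel] at this
  exact this.symm

theorem exists_not_asc {n : ℕ} {w : Equiv.Perm (Fin n)} (hw : w ≠ 1) : ∃ i : Idx n, ¬ Asc i w := by
  by_contra! H
  apply hw
  have hmono : StrictMono (w⁻¹ : Equiv.Perm (Fin n)) := by
    rcases n with _ | n
    · exact fun a => a.elim0
    · rw [Fin.strictMono_iff_lt_succ]
      intro a
      have := H ⟨a.1 + 1, by omega, by omega⟩
      simpa [Asc, letter, Fin.succ, Fin.castSucc, Fin.castAdd, Fin.castLE] using this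
  have h2 : (hmono.orderIsoOfSurjective _ (w⁻¹).surjective) = OrderIso.refl _ :=
    Subsingleton.elim _ _
  have h3 : w⁻¹ = 1 := by
    ext x
    have := congrArg (fun e => (e x).1) h2
    simpa using this
  simpa using h3

theorem wordProd_cons {n : ℕ} (i : Idx n) (l : List (Idx n)) :
    wordProd (i :: l) = simple i * wordProd l := by simp [wordProd]

theorem exists_word {n : ℕ} (w : Equiv.Perm (Fin n)) :
    ∃ l : List (Idx n), wordProd l = w ∧ l.length = (invSet w).card := by
  induction hN : (invSet w).card generalizing w with
  | zero =>
    by_cases hw : w = 1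
    · exact ⟨[], by simp [wordProd, hw], rfl⟩
    · obtain ⟨i, hi⟩ := exists_not_asc hw
      have := card_invSet_of_not_asc hi
      omega
  | succ N ih =>
    have hw : w ≠ 1 := by
      rintro rfl
      simp [invSet_one] at hN
    obtain ⟨i, hi⟩ := exists_not_asc hw
    have := card_invSet_of_not_asc hi
    obtain ⟨l, hl, hlen⟩ := ih (simple i * w) (by omega)
    exact ⟨i :: l, by rw [wordProd_cons, hl, simple_mul_cancel], by simp [hlen]⟩

theorem card_invSet_le {n : ℕ} (l : List (Idx n)) : (invSet (wordProd l)).card ≤ l.length := by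
  induction l with
  | nil => simp [wordProd, invSet_one]
  | cons i l ih =>
    rw [wordProd_cons, List.length_cons]
    by_cases h : Asc i (wordProd l)
    · have := card_invSet_of_asc h; omega
    · have := card_invSet_of_not_asc h; omega

theorem isReduced_iff {n : ℕ} (l : List (Idx n)) :
    IsReduced l ↔ l.length = (invSet (wordProd l)).card := by
  constructor
  · intro h
    obtain ⟨l', h1, h2⟩ := exists_word (wordProd l)
    exact le_antisymm (h2 ▸ h l' h1) (card_invSet_le l)
  · intro h l' h'
    rw [h, ← h']
    exact card_invSet_le l'

theorem exists_reduced {n : ℕ} (w : Equiv.Perm (Fin n)) :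
    ∃ l : List (Idx n), IsReduced l ∧ wordProd l = w := by
  obtain ⟨l, h1, h2⟩ := exists_word w
  exact ⟨l, (isReduced_iff l).2 (by rw [h1, h2]), h1⟩

theorem isReduced_cons {n : ℕ} (i : Idx n) (l : List (Idx n)) :
    IsReduced (i :: l) ↔ IsReduced l ∧ Asc i (wordProd l) := by
  rw [isReduced_iff, isReduced_iff, wordProd_cons, List.length_cons]
  have := card_invSet_le l
  by_cases h : Asc i (wordProd l)
  · have := card_invSet_of_asc h
    simp only [h, and_true]; omega
  · have := card_invSet_of_not_asc h
    simp only [h, and_false, iff_false]; omega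


/-! ### Words in a monoid satisfying the braid relations -/

theorem reduced_word_independent {n : ℕ} {M : Type*} [Monoid M] (f : Idx n → M)
    (hc : ∀ i j : Idx n, i.1 + 2 ≤ j.1 → f i * f j = f j * f i)
    (hb : ∀ i j : Idx n, j.1 = i.1 + 1 → f i * f j * f i = f j * f i * f j)
    (l l' : List (Idx n)) (hl : IsReduced l) (hl' : IsReduced l')
    (h : wordProd l = wordProd l') : (l.map f).prod = (l'.map f).prod := by
  induction hN : l.length using Nat.strong_induction_on generalizing l l' with
  | _ N ih =>
  have hlen : l.length = l'.length := by
    rw [(isReduced_iff l).1 hl, (isReduced_iff l').1 hl', h]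
  rcases l with _ | ⟨i, α⟩
  · rw [List.length_nil] at hlen
    rw [List.length_eq_zero_iff.1 hlen.symm]
  rcases l' with _ | ⟨j, β⟩
  · simp at hlen
  have hα := ((isReduced_cons i α).1 hl)
  have hβ := ((isReduced_cons j β).1 hl')
  simp only [List.length_cons] at hlen hN
  rw [wordProd_cons, wordProd_cons] at h
  -- the claim for `f` applied to two words with the same first letter
  have key : ∀ (i : Idx n) (γ δ : List (Idx n)), IsReduced (i :: γ) → IsReduced (i :: δ) →
      wordProd (i :: γ) = wordProd (i :: δ) → γ.length < N →
      ((i :: γ).map f).prod = ((i :: δ).map f).prod := by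
    intro i γ δ h1 h2 h3 h4
    rw [wordProd_cons, wordProd_cons] at h3
    simp only [List.map_cons, List.prod_cons]
    rw [ih γ.length h4 γ δ ((isReduced_cons i γ).1 h1).1 ((isReduced_cons i δ).1 h2).1
      (mul_left_cancel h3) rfl]
  set w := simple i * wordProd α with hw
  have hiw : ¬ Asc i w := fun h' => (asc_simple_mul i _).1 h' hα.2
  have hjw : ¬ Asc j w := fun h' => (asc_simple_mul j _).1 (h ▸ h') hβ.2
  by_cases hij : i = j
  · subst hij
    exact key i α β hl hl' (by rw [wordProd_cons, wordProd_cons, ← hw, h]) (by omega)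
  -- a reduced word of `w` starting with `i` and one starting with `j`, equal under `f`
  suffices H : ∀ i j : Idx n, i.1 < j.1 → ¬ Asc i w → ¬ Asc j w →
      ∃ γ δ : List (Idx n), IsReduced (i :: γ) ∧ IsReduced (j :: δ) ∧ wordProd (i :: γ) = w ∧
        wordProd (j :: δ) = w ∧ ((i :: γ).map f).prod = ((j :: δ).map f).prod by
    obtain ⟨γ, δ, h1, h2, h3, h4, h5⟩ : ∃ γ δ : List (Idx n), IsReduced (i :: γ) ∧
        IsReduced (j :: δ) ∧ wordProd (i :: γ) = w ∧
        wordProd (j :: δ) = w ∧ ((i :: γ).map f).prod = ((j :: δ).map f).prod := by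
      rcases lt_or_gt_of_ne (fun e => hij (Subtype.ext e)) with hlt | hlt
      · exact H i j hlt hiw hjw
      · obtain ⟨γ, δ, h1, h2, h3, h4, h5⟩ := H j i hlt hjw hiw
        exact ⟨δ, γ, h2, h1, h4, h3, h5.symm⟩
    rw [key i α γ hl h1 (by rw [wordProd_cons, ← hw, h3]) (by omega), h5,
      ← key j β δ hl' h2 (by rw [wordProd_cons, ← h, h4]) (by omega)]
  clear_value w
  intro i j hlt hi hj
  have red : ∀ (i : Idx n) (γ : List (Idx n)) (u : Equiv.Perm (Fin n)), IsReduced γ →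
      wordProd γ = u → Asc i u → IsReduced (i :: γ) := fun i γ u h1 h2 h3 =>
    (isReduced_cons i γ).2 ⟨h1, by rw [h2]; exact h3⟩
  have hi2 := i.2
  have hj2 := j.2
  set x := w⁻¹ (letter i.1 ⟨i.2.1, i.2.2.le⟩) with hx
  set y := w⁻¹ (letter (i.1 + 1) ⟨by omega, i.2.2⟩) with hy
  have hxy : y < x := by
    refine lt_of_le_of_ne (not_lt.1 hi) fun e => ?_
    have := (w⁻¹).injective e
    simp [letter] at this
    omega
  by_cases hfar : i.1 + 2 ≤ j.1
  · obtain ⟨γ, hγ, hγw⟩ := exists_reduced (simple i * (simple j * w))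
    have e1 : simple i * (simple j * w) = simple j * (simple i * w) := by
      rw [← mul_assoc, ← mul_assoc, simple_comm i j (Or.inl hfar)]
    have a1 : Asc i (simple i * (simple j * w)) := by
      rw [asc_simple_mul]
      intro h'
      apply hi
      simp only [Asc, mul_inv_rev, simple_inv, Equiv.Perm.mul_apply] at h' ⊢
      rwa [simple, Equiv.swap_apply_of_ne_of_ne, Equiv.swap_apply_of_ne_of_ne] at h' <;>
        simp [letter] <;> omega
    have a2 : Asc j (simple i * (simple j * w)) := by
      rw [e1, asc_simple_mul]
      intro h'
      apply hj
      simp only [Asc, mul_inv_rev, simple_inv, Equiv.Perm.mul_apply] at h' ⊢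
      rwa [simple, Equiv.swap_apply_of_ne_of_ne, Equiv.swap_apply_of_ne_of_ne] at h' <;>
        simp [letter] <;> omega
    have b1 := red i γ _ hγ hγw a1
    have b2 := red j γ _ hγ hγw a2
    refine ⟨j :: γ, i :: γ, red i _ (simple i * w) b2 ?_ ((asc_simple_mul i w).2 hi),
      red j _ (simple j * w) b1 ?_ ((asc_simple_mul j w).2 hj), ?_, ?_, ?_⟩
    · rw [wordProd_cons, hγw, e1, simple_mul_cancel]
    · rw [wordProd_cons, hγw, simple_mul_cancel]
    · rw [wordProd_cons, wordProd_cons, hγw, e1, simple_mul_cancel, simple_mul_cancel]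
    · rw [wordProd_cons, wordProd_cons, hγw, simple_mul_cancel, simple_mul_cancel]
    · simp only [List.map_cons, List.prod_cons]
      rw [← mul_assoc, ← mul_assoc, hc i j hfar]
  · have hj1 : j.1 = i.1 + 1 := by omega
    obtain ⟨i, hi3⟩ := i
    obtain ⟨j, hj3⟩ := j
    dsimp only at hj1
    subst hj1
    set I : Idx n := ⟨i, hi3⟩
    set J : Idx n := ⟨i + 1, hj3⟩
    set z := w⁻¹ (letter (i + 1 + 1) ⟨by omega, hj3.2⟩) with hz
    have hyz : z < y := by
      refine lt_of_le_of_ne (not_lt.1 hj) fun e => ?_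
      have := (w⁻¹).injective e
      simp [letter] at this
    have sI1 : simple I (letter i ⟨hi3.1, hi3.2.le⟩) = letter (i + 1) ⟨by omega, hi3.2⟩ :=
      Equiv.swap_apply_left _ _
    have sI2 : simple I (letter (i + 1) ⟨by omega, hi3.2⟩) = letter i ⟨hi3.1, hi3.2.le⟩ :=
      Equiv.swap_apply_right _ _
    have sI3 : simple I (letter (i + 1 + 1) ⟨by omega, hj3.2⟩)
        = letter (i + 1 + 1) ⟨by omega, hj3.2⟩ :=
      Equiv.swap_apply_of_ne_of_ne (by simp [letter, I]; omega) (by simp [letter, I])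
    have sJ1 : simple J (letter (i + 1) ⟨by omega, hi3.2⟩)
        = letter (i + 1 + 1) ⟨by omega, hj3.2⟩ :=
      Equiv.swap_apply_left _ _
    have sJ2 : simple J (letter (i + 1 + 1) ⟨by omega, hj3.2⟩)
        = letter (i + 1) ⟨by omega, hi3.2⟩ :=
      Equiv.swap_apply_right _ _
    have sJ3 : simple J (letter i ⟨hi3.1, hi3.2.le⟩) = letter i ⟨hi3.1, hi3.2.le⟩ :=
      Equiv.swap_apply_of_ne_of_ne (by simp [letter, J]; omega) (by simp [letter, J])
    obtain ⟨γ, hγ, hγw⟩ := exists_reduced (simple I * (simple J * (simple I * w)))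
    have e1 : simple I * (simple J * (simple I * w)) = simple J * (simple I * (simple J * w)) := by
      simp only [← mul_assoc]
      rw [simple_braid I J rfl]
    have aJ1 : ¬ Asc J (simple I * w) := by
      simp only [Asc, mul_inv_rev, simple_inv, Equiv.Perm.mul_apply]
      change ¬ w⁻¹ (simple I (letter (i + 1) _)) < w⁻¹ (simple I (letter (i + 1 + 1) _))
      rw [sI2, sI3]; exact not_lt.2 (hyz.trans hxy).le
    have aI1 : ¬ Asc I (simple J * w) := by
      simp only [Asc, mul_inv_rev, simple_inv, Equiv.Perm.mul_apply]
      change ¬ w⁻¹ (simple J (letter i _)) < w⁻¹ (simple J (letter (i + 1) _))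
      rw [sJ3, sJ1]; exact not_lt.2 (hyz.trans hxy).le
    have aI2 : ¬ Asc I (simple J * (simple I * w)) := by
      simp only [Asc, mul_inv_rev, simple_inv, Equiv.Perm.mul_apply]
      change ¬ w⁻¹ (simple I (simple J (letter i _))) < w⁻¹ (simple I (simple J (letter (i + 1) _)))
      rw [sJ3, sJ1, sI1, sI3]; exact not_lt.2 hyz.le
    have aJ2 : ¬ Asc J (simple I * (simple J * w)) := by
      simp only [Asc, mul_inv_rev, simple_inv, Equiv.Perm.mul_apply]
      change ¬ w⁻¹ (simple J (simple I (letter (i + 1) _)))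
        < w⁻¹ (simple J (simple I (letter (i + 1 + 1) _)))
      rw [sI2, sI3, sJ3, sJ2]; exact not_lt.2 hxy.le
    have b1 := red I γ _ hγ hγw ((asc_simple_mul I _).2 aI2)
    have p1 : wordProd (I :: γ) = simple J * (simple I * w) := by
      rw [wordProd_cons, hγw, simple_mul_cancel]
    have b2 := red J _ _ b1 p1 ((asc_simple_mul J _).2 aJ1)
    have p2 : wordProd (J :: I :: γ) = simple I * w := by
      rw [wordProd_cons, p1, simple_mul_cancel]
    have b3 := red I _ _ b2 p2 ((asc_simple_mul I _).2 hi)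
    have c1 := red J γ _ hγ (hγw.trans e1) ((asc_simple_mul J _).2 aJ2)
    have q1 : wordProd (J :: γ) = simple I * (simple J * w) := by
      rw [wordProd_cons, hγw, e1, simple_mul_cancel]
    have c2 := red I _ _ c1 q1 ((asc_simple_mul I _).2 aI1)
    have q2 : wordProd (I :: J :: γ) = simple J * w := by
      rw [wordProd_cons, q1, simple_mul_cancel]
    have c3 := red J _ _ c2 q2 ((asc_simple_mul J _).2 hj)
    refine ⟨J :: I :: γ, I :: J :: γ, b3, c3, ?_, ?_, ?_⟩
    · rw [wordProd_cons, p2, simple_mul_cancel]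
    · rw [wordProd_cons, q2, simple_mul_cancel]
    · simp only [List.map_cons, List.prod_cons, ← mul_assoc]
      rw [hb I J rfl]

/-! ### The Iwahori–Hecke algebra -/

/-- The defining relations of the Iwahori–Hecke algebra with its normalized generators;
the indeterminate `ξ` is `X : ℤ[X]`. -/
inductive HeckeRel (n : ℕ) : FreeAlgebra ℤ[X] (Idx n) → FreeAlgebra ℤ[X] (Idx n) → Prop
  | comm (i j : Idx n) (h : i.1 + 2 ≤ j.1 ∨ j.1 + 2 ≤ i.1) :
      HeckeRel n (FreeAlgebra.ι ℤ[X] i * FreeAlgebra.ι ℤ[X] j)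
        (FreeAlgebra.ι ℤ[X] j * FreeAlgebra.ι ℤ[X] i)
  | braid (i j : Idx n) (h : j.1 = i.1 + 1) :
      HeckeRel n (FreeAlgebra.ι ℤ[X] i * FreeAlgebra.ι ℤ[X] j * FreeAlgebra.ι ℤ[X] i)
        (FreeAlgebra.ι ℤ[X] j * FreeAlgebra.ι ℤ[X] i * FreeAlgebra.ι ℤ[X] j)
  | quad (i : Idx n) :
      HeckeRel n (FreeAlgebra.ι ℤ[X] i * FreeAlgebra.ι ℤ[X] i)
        (1 + (X : ℤ[X]) • FreeAlgebra.ι ℤ[X] i)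

/-- The Iwahori–Hecke algebra `ℋ_n` of the symmetric group on `n` letters over `ℤ[ξ]`. -/
abbrev HeckeAlgebra (n : ℕ) : Type := RingQuot (HeckeRel n)

/-- The generator `T_{s_i}` of the Iwahori–Hecke algebra. -/
noncomputable def gen {n : ℕ} (i : Idx n) : HeckeAlgebra n :=
  RingQuot.mkAlgHom ℤ[X] (HeckeRel n) (FreeAlgebra.ι ℤ[X] i)

/-- `T_w = T_{s_{i_1}} ⋯ T_{s_{i_r}}` for a reduced word `(i_1, …, i_r)` of `w`; by
`T_eq` below the choice of the reduced word does not matter. -/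
noncomputable def T {n : ℕ} (w : Equiv.Perm (Fin n)) : HeckeAlgebra n :=
  ((exists_reduced w).choose.map gen).prod

theorem gen_comm {n : ℕ} (i j : Idx n) (h : i.1 + 2 ≤ j.1) :
    gen i * gen j = gen j * gen i := by
  simpa [gen] using RingQuot.mkAlgHom_rel ℤ[X] (HeckeRel.comm i j (Or.inl h))

theorem gen_braid {n : ℕ} (i j : Idx n) (h : j.1 = i.1 + 1) :
    gen i * gen j * gen i = gen j * gen i * gen j := by
  simpa [gen] using RingQuot.mkAlgHom_rel ℤ[X] (HeckeRel.braid i j h)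

theorem gen_sq {n : ℕ} (i : Idx n) : gen i * gen i = 1 + (X : ℤ[X]) • gen i := by
  simpa [gen] using RingQuot.mkAlgHom_rel ℤ[X] (HeckeRel.quad i)

theorem T_eq {n : ℕ} (w : Equiv.Perm (Fin n)) (l : List (Idx n)) (hl : IsReduced l)
    (h : wordProd l = w) : T w = (l.map gen).prod :=
  reduced_word_independent gen gen_comm gen_braid _ l (exists_reduced w).choose_spec.1 hl
    ((exists_reduced w).choose_spec.2.trans h.symm)

theorem T_one {n : ℕ} : T (1 : Equiv.Perm (Fin n)) = 1 :=
  T_eq 1 [] (fun _ _ => Nat.zero_le _) rfl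

theorem gen_mul_T_of_asc {n : ℕ} {i : Idx n} {w : Equiv.Perm (Fin n)} (h : Asc i w) :
    gen i * T w = T (simple i * w) := by
  obtain ⟨l, hl, hw⟩ := exists_reduced w
  rw [T_eq w l hl hw, T_eq (simple i * w) (i :: l) ((isReduced_cons i l).2 ⟨hl, hw ▸ h⟩)
    (by rw [wordProd_cons, hw])]
  simp

theorem gen_mul_T_of_not_asc {n : ℕ} {i : Idx n} {w : Equiv.Perm (Fin n)} (h : ¬ Asc i w) :
    gen i * T w = T (simple i * w) + (X : ℤ[X]) • T w := by
  have h1 := gen_mul_T_of_asc ((asc_simple_mul i w).2 h)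
  rw [simple_mul_cancel] at h1
  rw [← h1, ← mul_assoc, gen_sq, add_mul, one_mul, smul_mul_assoc]

/-! ### The basis `T_w` -/

open Classical in
/-- Left multiplication by `T_{s_i}` in coordinates. -/
noncomputable def leftOp {n : ℕ} (i : Idx n) : Module.End ℤ[X] (Equiv.Perm (Fin n) →₀ ℤ[X]) :=
  Finsupp.linearCombination ℤ[X] fun w =>
    Finsupp.single (simple i * w) 1 + if Asc i w then 0 else (X : ℤ[X]) • Finsupp.single w 1

theorem leftOp_of_asc {n : ℕ} {i : Idx n} {w : Equiv.Perm (Fin n)} (h : Asc i w) :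
    leftOp i (Finsupp.single w 1) = Finsupp.single (simple i * w) 1 := by
  simp [leftOp, h]

theorem leftOp_of_not_asc {n : ℕ} {i : Idx n} {w : Equiv.Perm (Fin n)} (h : ¬ Asc i w) :
    leftOp i (Finsupp.single w 1)
      = Finsupp.single (simple i * w) 1 + (X : ℤ[X]) • Finsupp.single w 1 := by
  simp [leftOp, h]

theorem leftOp_sq {n : ℕ} (i : Idx n) :
    leftOp i * leftOp i = 1 + (X : ℤ[X]) • leftOp i := by
  apply Finsupp.lhom_ext'
  intro w
  apply LinearMap.ext_ring
  simp only [LinearMap.comp_apply, Finsupp.lsingle_apply, Module.End.mul_apply,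
    LinearMap.add_apply, LinearMap.smul_apply, Module.End.one_apply]
  by_cases h : Asc i w
  · have h2 : ¬ Asc i (simple i * w) := fun h' => (asc_simple_mul i w).1 h' h
    rw [leftOp_of_asc h, leftOp_of_not_asc h2, simple_mul_cancel]
  · rw [leftOp_of_not_asc h, map_add, map_smul, leftOp_of_asc ((asc_simple_mul i w).2 h),
      simple_mul_cancel, leftOp_of_not_asc h]

theorem leftOp_comm {n : ℕ} (i j : Idx n) (h : i.1 + 2 ≤ j.1) :
    leftOp i * leftOp j = leftOp j * leftOp i := by
  have hi := i.2
  have hj := j.2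
  apply Finsupp.lhom_ext'
  intro w
  apply LinearMap.ext_ring
  simp only [LinearMap.comp_apply, Finsupp.lsingle_apply, Module.End.mul_apply]
  have a1 : Asc i (simple j * w) ↔ Asc i w := by
    simp only [Asc, mul_inv_rev, simple_inv, Equiv.Perm.mul_apply]
    rw [simple, Equiv.swap_apply_of_ne_of_ne, Equiv.swap_apply_of_ne_of_ne] <;>
      simp [letter] <;> omega
  have a2 : Asc j (simple i * w) ↔ Asc j w := by
    simp only [Asc, mul_inv_rev, simple_inv, Equiv.Perm.mul_apply]
    rw [simple, Equiv.swap_apply_of_ne_of_ne, Equiv.swap_apply_of_ne_of_ne] <;>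
      simp [letter] <;> omega
  have e : simple i * (simple j * w) = simple j * (simple i * w) := by
    rw [← mul_assoc, ← mul_assoc, simple_comm i j (Or.inl h)]
  simp only [leftOp, Finsupp.linearCombination_single, one_smul, map_add, a1, a2, e]
  by_cases h1 : Asc i w <;> by_cases h2 : Asc j w <;> (simp [h1, h2, a1, a2]; try abel)

theorem leftOp_braid {n : ℕ} (i j : Idx n) (h : j.1 = i.1 + 1) :
    leftOp i * leftOp j * leftOp i = leftOp j * leftOp i * leftOp j := by
  obtain ⟨i, hi3⟩ := i
  obtain ⟨j, hj3⟩ := j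
  dsimp only at h
  subst h
  set I : Idx n := ⟨i, hi3⟩
  set J : Idx n := ⟨i + 1, hj3⟩
  have sI1 : simple I (letter i ⟨hi3.1, hi3.2.le⟩) = letter (i + 1) ⟨by omega, hi3.2⟩ :=
    Equiv.swap_apply_left _ _
  have sI2 : simple I (letter (i + 1) ⟨by omega, hi3.2⟩) = letter i ⟨hi3.1, hi3.2.le⟩ :=
    Equiv.swap_apply_right _ _
  have sI3 : simple I (letter (i + 1 + 1) ⟨by omega, hj3.2⟩)
      = letter (i + 1 + 1) ⟨by omega, hj3.2⟩ :=
    Equiv.swap_apply_of_ne_of_ne (by simp [letter, I]; omega) (by simp [letter, I])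
  have sJ1 : simple J (letter (i + 1) ⟨by omega, hi3.2⟩)
      = letter (i + 1 + 1) ⟨by omega, hj3.2⟩ :=
    Equiv.swap_apply_left _ _
  have sJ2 : simple J (letter (i + 1 + 1) ⟨by omega, hj3.2⟩)
      = letter (i + 1) ⟨by omega, hi3.2⟩ :=
    Equiv.swap_apply_right _ _
  have sJ3 : simple J (letter i ⟨hi3.1, hi3.2.le⟩) = letter i ⟨hi3.1, hi3.2.le⟩ :=
    Equiv.swap_apply_of_ne_of_ne (by simp [letter, J]; omega) (by simp [letter, J])
  apply Finsupp.lhom_ext'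
  intro w
  apply LinearMap.ext_ring
  simp only [LinearMap.comp_apply, Finsupp.lsingle_apply, Module.End.mul_apply]
  have AI : ∀ u : Equiv.Perm (Fin n), Asc I u ↔
      u⁻¹ (letter i ⟨hi3.1, hi3.2.le⟩) < u⁻¹ (letter (i + 1) ⟨by omega, hi3.2⟩) :=
    fun _ => Iff.rfl
  have AJ : ∀ u : Equiv.Perm (Fin n), Asc J u ↔
      u⁻¹ (letter (i + 1) ⟨by omega, hi3.2⟩) < u⁻¹ (letter (i + 1 + 1) ⟨by omega, hj3.2⟩) :=
    fun _ => Iff.rfl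
  have e1 : simple J * (simple I * (simple J * w)) = simple I * (simple J * (simple I * w)) := by
    simp only [← mul_assoc]
    rw [simple_braid I J rfl]
  have hxy : w⁻¹ (letter i ⟨hi3.1, hi3.2.le⟩) ≠ w⁻¹ (letter (i + 1) ⟨by omega, hi3.2⟩) := by
    rw [(w⁻¹).injective.ne_iff]; simp [letter]; omega
  have hyz : w⁻¹ (letter (i + 1) ⟨by omega, hi3.2⟩) ≠
      w⁻¹ (letter (i + 1 + 1) ⟨by omega, hj3.2⟩) := by
    rw [(w⁻¹).injective.ne_iff]; simp [letter]
  have hxz : w⁻¹ (letter i ⟨hi3.1, hi3.2.le⟩) ≠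
      w⁻¹ (letter (i + 1 + 1) ⟨by omega, hj3.2⟩) := by
    rw [(w⁻¹).injective.ne_iff]; simp [letter]
  rcases lt_or_gt_of_ne hxy with h1 | h1 <;> rcases lt_or_gt_of_ne hyz with h2 | h2 <;>
    rcases lt_or_gt_of_ne hxz with h3 | h3 <;>
    first
    | exact absurd (h1.trans h2) (not_lt.2 h3.le)
    | exact absurd (h2.trans h1) (not_lt.2 h3.le)
    | (simp only [leftOp, Finsupp.linearCombination_single, one_smul, map_add, map_smul, AI, AJ,
        mul_inv_rev, simple_inv, Equiv.Perm.mul_apply, sI1, sI2, sI3, sJ1, sJ2, sJ3, h1, h2, h3,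
        not_lt.2 h1.le, not_lt.2 h2.le, not_lt.2 h3.le, if_true, if_false, add_zero,
        simple_mul_cancel, e1, smul_add]
       try abel)

/-- The action of the Hecke algebra on coordinate vectors. -/
noncomputable def leftRep (n : ℕ) :
    HeckeAlgebra n →ₐ[ℤ[X]] Module.End ℤ[X] (Equiv.Perm (Fin n) →₀ ℤ[X]) :=
  RingQuot.liftAlgHom ℤ[X] ⟨FreeAlgebra.lift ℤ[X] leftOp, by
    intro a b hab
    induction hab with
    | comm i j h =>
      simp only [map_mul, FreeAlgebra.lift_ι_apply]
      rcases h with h | h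
      · exact leftOp_comm i j h
      · exact (leftOp_comm j i h).symm
    | braid i j h =>
      simp only [map_mul, FreeAlgebra.lift_ι_apply]
      exact leftOp_braid i j h
    | quad i =>
      simp only [map_mul, map_add, map_one, map_smul, FreeAlgebra.lift_ι_apply]
      exact leftOp_sq i⟩

theorem leftRep_gen {n : ℕ} (i : Idx n) : leftRep n (gen i) = leftOp i := by
  simp [leftRep, gen]

theorem leftRep_T {n : ℕ} (w : Equiv.Perm (Fin n)) :
    leftRep n (T w) (Finsupp.single 1 1) = Finsupp.single w 1 := by
  obtain ⟨l, hl, rfl⟩ := exists_reduced w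
  rw [T_eq _ l hl rfl]
  induction l with
  | nil => simp [wordProd]
  | cons i l ih =>
    obtain ⟨h1, h2⟩ := (isReduced_cons i l).1 hl
    rw [List.map_cons, List.prod_cons, map_mul, Module.End.mul_apply, ih h1, leftRep_gen,
      leftOp_of_asc h2, wordProd_cons]

theorem linearIndependent_T (n : ℕ) :
    LinearIndependent ℤ[X] (T : Equiv.Perm (Fin n) → HeckeAlgebra n) := by
  apply LinearIndependent.of_comp
    ((LinearMap.applyₗ (Finsupp.single (1 : Equiv.Perm (Fin n)) (1 : ℤ[X]))).comp
      (leftRep n).toLinearMap)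
  have : (((LinearMap.applyₗ (Finsupp.single (1 : Equiv.Perm (Fin n)) (1 : ℤ[X]))).comp
      (leftRep n).toLinearMap) ∘ T) = fun w => Finsupp.single w 1 := by
    funext w
    simp [leftRep_T]
  rw [this]
  exact Finsupp.linearIndependent_single_one _ _

theorem span_T (n : ℕ) :
    ⊤ ≤ Submodule.span ℤ[X] (Set.range (T : Equiv.Perm (Fin n) → HeckeAlgebra n)) := by
  set N := Submodule.span ℤ[X] (Set.range (T : Equiv.Perm (Fin n) → HeckeAlgebra n))
  have hT : ∀ w, T w ∈ N := fun w => Submodule.subset_span ⟨w, rfl⟩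
  have hgen : ∀ i, ∀ y ∈ N, gen i * y ∈ N := by
    intro i y hy
    induction hy using Submodule.span_induction with
    | mem x hx =>
      obtain ⟨w, rfl⟩ := hx
      by_cases h : Asc i w
      · rw [gen_mul_T_of_asc h]; exact hT _
      · rw [gen_mul_T_of_not_asc h]; exact N.add_mem (hT _) (N.smul_mem _ (hT _))
    | zero => rw [mul_zero]; exact N.zero_mem
    | add a b _ _ ha hb => rw [mul_add]; exact N.add_mem ha hb
    | smul c a _ ha => rw [mul_smul_comm]; exact N.smul_mem _ ha
  have hall : ∀ (a : FreeAlgebra ℤ[X] (Idx n)), ∀ y ∈ N,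
      RingQuot.mkAlgHom ℤ[X] (HeckeRel n) a * y ∈ N := by
    intro a
    induction a using FreeAlgebra.induction with
    | grade0 r =>
      intro y hy
      rw [AlgHom.commutes, ← Algebra.smul_def]; exact N.smul_mem _ hy
    | grade1 i => exact hgen i
    | mul a b ha hb =>
      intro y hy
      rw [map_mul, mul_assoc]; exact ha _ (hb _ hy)
    | add a b ha hb =>
      intro y hy
      rw [map_add, add_mul]; exact N.add_mem (ha _ hy) (hb _ hy)
  intro x _
  obtain ⟨a, rfl⟩ := RingQuot.mkAlgHom_surjective ℤ[X] (HeckeRel n) x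
  have := hall a (T 1) (hT 1)
  rwa [T_one, mul_one] at this

/-- The `ℤ[ξ]`-basis of the Hecke algebra consisting of the elements `T_w`. -/
noncomputable def basisT (n : ℕ) : Module.Basis (Equiv.Perm (Fin n)) ℤ[X] (HeckeAlgebra n) :=
  Module.Basis.mk (linearIndependent_T n) (span_T n)

theorem basisT_apply {n : ℕ} (w : Equiv.Perm (Fin n)) : basisT n w = T w :=
  Module.Basis.mk_apply _ _ w

/-- The structure constant `f_{xyz}`: the coefficient of `T_z` in `T_x T_y`. -/
noncomputable def structConst {n : ℕ} (x y z : Equiv.Perm (Fin n)) : ℤ[X] :=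
  (basisT n).repr (T x * T y) z

/-- The inclusion of `ℕ[ξ]` in `ℤ[ξ]`. -/
noncomputable def natPoly : ℕ[X] →+* ℤ[X] := Polynomial.mapRingHom (Nat.castRingHom ℤ)

/-! ### The elements `d_m` and the subgroups `P_m` -/

/-- `#(w)`: the least number of occurrences of `s_k` in a reduced word of `w`. -/
noncomputable def hash {n : ℕ} (k : Idx n) (w : Equiv.Perm (Fin n)) : ℕ :=
  sInf {c | ∃ l : List (Idx n), IsReduced l ∧ wordProd l = w ∧ l.count k = c}

/-- The maximal parabolic subgroup `S_{(k, n-k)}`, generated by the `s_i` with `i ≠ k`. -/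
def maxParabolic {n : ℕ} (k : Idx n) : Subgroup (Equiv.Perm (Fin n)) :=
  Subgroup.closure (simple '' {i | i ≠ k})

/-- `d_m = (k  k+m)(k-1  k+m-1) ⋯ (k+1-m  k+1)`, for `0 ≤ m ≤ min k (n-k)`. -/
def dElt {n : ℕ} (k : Idx n) (m : ℕ) (hm : m ≤ min k.1 (n - k.1)) : Equiv.Perm (Fin n) :=
  (List.ofFn fun j : Fin m =>
    Equiv.swap (letter (k.1 - j.1) (by omega) : Fin n) (letter (k.1 + m - j.1) (by omega))).prod

/-- `P_m = S_λ ∩ S_λ^{d_m}` with `λ = (k, n-k)` and `S_λ^d = d⁻¹ S_λ d`. -/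
def P {n : ℕ} (k : Idx n) (m : ℕ) (hm : m ≤ min k.1 (n - k.1)) : Subgroup (Equiv.Perm (Fin n)) :=
  maxParabolic k ⊓ (maxParabolic k).map (MulAut.conj (dElt k m hm)⁻¹).toMonoidHom

end HeckeSym

/-!
The symmetric form for which the `T_w` are orthonormal makes left multiplication by `T_x` adjoint to
left multiplication by `T_{x⁻¹}`. So the coefficient of `T_w` in `T_{d⁻¹} T_d` is the pairing of
`T_d` with `T_d T_w`. When `d` has minimal length in `d W_J` and `w ∈ W_J`, the lengths of `d` and
`w` add up, `T_d T_w = T_{dw}`, and the pairing is `1` for `w = 1` and `0` otherwise. Positivity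
holds because each generator acts on the basis with coefficients `1` and `ξ`.

If `d` is also of minimal length in `W_K d`, and `v ∈ W_K` is such that `u = d⁻¹ v d` lies in `W_J`,
then `T_{d⁻¹} T_v = T_{d⁻¹ v} = T_{u d⁻¹} = T_u T_{d⁻¹}`. Hence `T_{d⁻¹} T_v T_d` is `T_u` times
`T_{d⁻¹} T_d`, and left multiplication by `T_u` preserves the span of the `T_w` with `w ∉ W_J`.
The involution `d_m` is such a `d` for `J = K = {i | i ≠ k}`.
-/

namespace HeckeSym

variable {n : ℕ}

/-! ### Words -/

theorem wordProd_append (l l' : List (Idx n)) :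
    wordProd (l ++ l') = wordProd l * wordProd l' := by simp [wordProd]

theorem wordProd_reverse (l : List (Idx n)) : wordProd l.reverse = (wordProd l)⁻¹ := by
  simp [wordProd, List.prod_inv_reverse, Function.comp_def, simple_inv]

theorem IsReduced.reverse {l : List (Idx n)} (hl : IsReduced l) : IsReduced l.reverse := by
  intro l' hl'
  rw [List.length_reverse, ← List.length_reverse (as := l')]
  exact hl _ (by rw [wordProd_reverse, hl', wordProd_reverse, inv_inv])

theorem IsReduced.of_append_left {l l' : List (Idx n)} (h : IsReduced (l ++ l')) :
    IsReduced l := by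
  intro p hp
  have hlen := h (p ++ l') (by rw [wordProd_append, wordProd_append, hp])
  simpa only [List.length_append, add_le_add_iff_right] using hlen

theorem IsReduced.of_append_right {l l' : List (Idx n)} (h : IsReduced (l ++ l')) :
    IsReduced l' := by
  intro p hp
  have hlen := h (l ++ p) (by rw [wordProd_append, wordProd_append, hp])
  simpa only [List.length_append, add_le_add_iff_left] using hlen

theorem IsReduced.T_wordProd {l : List (Idx n)} (hl : IsReduced l) :
    T (wordProd l) = (l.map gen).prod :=
  T_eq _ l hl rfl

theorem IsReduced.T_mul_T_wordProd {l l' : List (Idx n)} (h : IsReduced (l ++ l')) :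
    T (wordProd l) * T (wordProd l') = T (wordProd l * wordProd l') := by
  rw [← wordProd_append, h.T_wordProd, h.of_append_left.T_wordProd, h.of_append_right.T_wordProd,
    List.map_append, List.prod_append]

/-! ### Parabolic subgroups -/

section Parabolic

/-- The standard parabolic subgroup `W_J`, generated by the `s_i` with `i ∈ J`. The group
`S_{(k, n-k)}`, that is `maxParabolic k`, is `W_J` for `J = {i | i ≠ k}`. -/
def parabolic (J : Set (Idx n)) : Subgroup (Equiv.Perm (Fin n)) :=
  Subgroup.closure (simple '' J)

variable {J : Set (Idx n)} {w : Equiv.Perm (Fin n)}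

theorem simple_mem_parabolic {i : Idx n} (hi : i ∈ J) : simple i ∈ parabolic J :=
  Subgroup.subset_closure ⟨i, hi, rfl⟩

theorem wordProd_mem_parabolic {l : List (Idx n)} (hl : ∀ i ∈ l, i ∈ J) :
    wordProd l ∈ parabolic J := by
  refine Subgroup.list_prod_mem _ fun u hu => ?_
  obtain ⟨i, hi, rfl⟩ := List.mem_map.1 hu
  exact simple_mem_parabolic (hl i hi)

theorem apply_lt_iff_of_mem_parabolic {i : Idx n} (hi : i ∉ J) (hw : w ∈ parabolic J)
    (x : Fin n) : (w x).1 < i.1 ↔ x.1 < i.1 := by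
  induction hw using Subgroup.closure_induction generalizing x with
  | mem u hu =>
    obtain ⟨j, hj, rfl⟩ := hu
    have hji : j.1 ≠ i.1 := fun h => hi (Subtype.ext h ▸ hj)
    rw [simple_val]
    split_ifs <;> omega
  | one => rfl
  | mul a b _ _ ha hb => rw [Equiv.Perm.mul_apply, ha, hb]
  | inv a _ ha => rw [← ha, ← Equiv.Perm.mul_apply, mul_inv_cancel, Equiv.Perm.one_apply]

theorem asc_of_mem_parabolic {i : Idx n} (hi : i ∉ J) (hw : w ∈ parabolic J) : Asc i w := by
  have := i.2.1
  have hlow := apply_lt_iff_of_mem_parabolic hi (inv_mem hw) (letter i.1 ⟨i.2.1, i.2.2.le⟩)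
  have hhigh := apply_lt_iff_of_mem_parabolic hi (inv_mem hw)
    (letter (i.1 + 1) ⟨by omega, i.2.2⟩)
  simp only [letter] at hlow hhigh
  simp only [Asc, letter, Fin.lt_def]
  omega

theorem exists_reduced_of_mem_parabolic (hw : w ∈ parabolic J) :
    ∃ l : List (Idx n), IsReduced l ∧ wordProd l = w ∧ ∀ i ∈ l, i ∈ J := by
  induction hN : (invSet w).card using Nat.strong_induction_on generalizing w with
  | _ N ih =>
  obtain rfl | hw1 := eq_or_ne w 1
  · exact ⟨[], fun _ _ => Nat.zero_le _, rfl, by simp⟩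
  obtain ⟨i, hi⟩ := exists_not_asc hw1
  have hiJ : i ∈ J := by
    by_contra hiJ
    exact hi (asc_of_mem_parabolic hiJ hw)
  have hcard := card_invSet_of_not_asc hi
  obtain ⟨l, hl, hlw, hlJ⟩ :=
    ih _ (by omega) (mul_mem (simple_mem_parabolic hiJ) hw) rfl
  refine ⟨i :: l, (isReduced_cons i l).2 ⟨hl, ?_⟩, ?_, List.forall_mem_cons.2 ⟨hiJ, hlJ⟩⟩
  · exact hlw ▸ (asc_simple_mul i w).2 hi
  · rw [wordProd_cons, hlw, simple_mul_cancel]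

theorem hash_eq_zero_iff {k : Idx n} : hash k w = 0 ↔ w ∈ parabolic {i | i ≠ k} := by
  have hnonempty : {c | ∃ l : List (Idx n), IsReduced l ∧ wordProd l = w ∧ l.count k = c} ≠ ∅ := by
    obtain ⟨l, hl, hlw⟩ := exists_reduced w
    exact Set.Nonempty.ne_empty ⟨_, l, hl, hlw, rfl⟩
  rw [hash, Nat.sInf_eq_zero, or_iff_left hnonempty]
  constructor
  · rintro ⟨l, -, rfl, hcount⟩
    exact wordProd_mem_parabolic fun i hi h => List.count_eq_zero.1 hcount (h ▸ hi)
  · intro hw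
    obtain ⟨l, hl, hlw, hlk⟩ := exists_reduced_of_mem_parabolic hw
    exact ⟨l, hl, hlw, List.count_eq_zero.2 fun hk => hlk k hk rfl⟩

end Parabolic

/-! ### Minimal coset representatives -/

/-- `d` is the element of minimal length of its coset `W_J d`, expressed by `s_i d` being longer
than `d` for all `i ∈ J`. Minimality in `d W_J` is `IsMinCosetRep J d⁻¹`. -/
def IsMinCosetRep (J : Set (Idx n)) (d : Equiv.Perm (Fin n)) : Prop :=
  ∀ i ∈ J, Asc i d

namespace IsMinCosetRep

variable {J : Set (Idx n)} {d w : Equiv.Perm (Fin n)}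

theorem inv_apply_lt_inv_apply (hd : IsMinCosetRep J d) {a b : Fin n} (hab : a < b)
    (hJ : ∀ i : Idx n, a.1 < i.1 → i.1 ≤ b.1 → i ∈ J) : d⁻¹ a < d⁻¹ b := by
  obtain ⟨b, hb⟩ := b
  obtain ⟨c, rfl⟩ := Nat.exists_eq_add_of_lt (Fin.lt_def.1 hab)
  induction c with
  | zero => exact hd ⟨a.1 + 1, by omega, hb⟩ (hJ _ (Nat.lt_succ_self _) le_rfl)
  | succ c ih =>
    have hac : a.1 < a.1 + c + 1 := by omega
    have hlt : d⁻¹ a < d⁻¹ ⟨a.1 + c + 1, by omega⟩ :=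
      ih (by omega) (Fin.lt_def.2 hac) fun i hai hib => hJ i hai (Nat.le_succ_of_le hib)
    exact hlt.trans (hd ⟨a.1 + c + 1 + 1, by omega, hb⟩ (hJ _ (Nat.lt_succ_of_lt hac) le_rfl))

theorem asc_mul (hd : IsMinCosetRep J d) (hw : w ∈ parabolic J) {i : Idx n} (hi : i ∈ J)
    (hiw : Asc i w) : Asc i (w * d) := by
  rw [Asc, mul_inv_rev, Equiv.Perm.mul_apply, Equiv.Perm.mul_apply]
  refine hd.inv_apply_lt_inv_apply hiw fun j hlow hhigh => ?_
  by_contra hj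
  have hlow' := (apply_lt_iff_of_mem_parabolic hj (inv_mem hw) _).1 hlow
  have hhigh' := mt (apply_lt_iff_of_mem_parabolic hj (inv_mem hw) _).2 hhigh.not_gt
  have hji : j.1 ≠ i.1 := fun h => hj (Subtype.ext h ▸ hi)
  simp only [letter] at hlow' hhigh'
  omega

theorem isReduced_append {l l' : List (Idx n)} (hd : IsMinCosetRep J (wordProd l'))
    (hl : IsReduced l) (hlJ : ∀ i ∈ l, i ∈ J) (hl' : IsReduced l') : IsReduced (l ++ l') := by
  induction l with
  | nil => exact hl'
  | cons i l ih =>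
    obtain ⟨hiJ, hlJ⟩ := List.forall_mem_cons.1 hlJ
    obtain ⟨hl, hi⟩ := (isReduced_cons i l).1 hl
    refine (isReduced_cons i (l ++ l')).2 ⟨ih hl hlJ, ?_⟩
    rw [wordProd_append]
    exact hd.asc_mul (wordProd_mem_parabolic hlJ) hiJ hi

theorem T_mul_T (hd : IsMinCosetRep J d) (hw : w ∈ parabolic J) : T w * T d = T (w * d) := by
  obtain ⟨l, hl, rfl, hlJ⟩ := exists_reduced_of_mem_parabolic hw
  obtain ⟨l', hl', rfl⟩ := exists_reduced d
  exact (hd.isReduced_append hl hlJ hl').T_mul_T_wordProd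

theorem T_inv_mul_T (hd : IsMinCosetRep J d) (hw : w ∈ parabolic J) :
    T d⁻¹ * T w = T (d⁻¹ * w) := by
  obtain ⟨l, hl, rfl, hlJ⟩ := exists_reduced_of_mem_parabolic hw
  obtain ⟨l', hl', rfl⟩ := exists_reduced d
  have h : IsReduced (l'.reverse ++ l) := by
    have hrev := hd.isReduced_append hl.reverse (by simpa only [List.mem_reverse] using hlJ) hl'
    simpa only [List.reverse_append, List.reverse_reverse] using hrev.reverse
  rw [← wordProd_reverse, h.T_mul_T_wordProd]

end IsMinCosetRep

/-! ### The form with orthonormal basis `T_w` -/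

theorem toDual_T_T (x y : Equiv.Perm (Fin n)) :
    (basisT n).toDual (T x) (T y) = if x = y then 1 else 0 := by
  rw [← basisT_apply, ← basisT_apply, Module.Basis.toDual_apply]

theorem toDual_gen_mul (i : Idx n) (a b : HeckeAlgebra n) :
    (basisT n).toDual (gen i * a) b = (basisT n).toDual a (gen i * b) := by
  suffices h : (basisT n).toDual ∘ₗ LinearMap.mulLeft ℤ[X] (gen i) =
      (basisT n).toDual.compl₂ (LinearMap.mulLeft ℤ[X] (gen i)) from LinearMap.congr_fun₂ h a b
  refine (basisT n).ext fun x => (basisT n).ext fun y => ?_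
  simp only [LinearMap.comp_apply, LinearMap.compl₂_apply, LinearMap.mulLeft_apply, basisT_apply]
  have hswap : simple i * x = y ↔ x = simple i * y := by
    rw [← eq_inv_mul_iff_mul_eq, simple_inv]
  by_cases hx : Asc i x <;> by_cases hy : Asc i y
  · simp only [gen_mul_T_of_asc hx, gen_mul_T_of_asc hy, toDual_T_T, hswap]
  · have hxy : x ≠ y := fun h => hy (h ▸ hx)
    simp [gen_mul_T_of_asc hx, gen_mul_T_of_not_asc hy, toDual_T_T, hswap, hxy]
  · have hxy : x ≠ y := fun h => hx (h ▸ hy)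
    simp [gen_mul_T_of_not_asc hx, gen_mul_T_of_asc hy, toDual_T_T, hswap, hxy]
  · simp [gen_mul_T_of_not_asc hx, gen_mul_T_of_not_asc hy, toDual_T_T, hswap]

theorem toDual_prod_gen_mul (l : List (Idx n)) (a b : HeckeAlgebra n) :
    (basisT n).toDual ((l.map gen).prod * a) b =
      (basisT n).toDual a ((l.reverse.map gen).prod * b) := by
  induction l generalizing b with
  | nil => simp
  | cons i l ih =>
    rw [List.map_cons, List.prod_cons, mul_assoc, toDual_gen_mul, ih]
    simp [mul_assoc]

theorem toDual_T_mul (x : Equiv.Perm (Fin n)) (a b : HeckeAlgebra n) :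
    (basisT n).toDual (T x * a) b = (basisT n).toDual a (T x⁻¹ * b) := by
  obtain ⟨l, hl, rfl⟩ := exists_reduced x
  rw [hl.T_wordProd, toDual_prod_gen_mul, ← wordProd_reverse, hl.reverse.T_wordProd]

theorem structConst_eq_toDual (x y z : Equiv.Perm (Fin n)) :
    structConst x y z = (basisT n).toDual (T y) (T x⁻¹ * T z) := by
  rw [← toDual_T_mul, ← basisT_apply z, Module.Basis.toDual_apply_left, structConst]

theorem IsMinCosetRep.structConst_inv_self {J : Set (Idx n)} {d w : Equiv.Perm (Fin n)}
    (hd : IsMinCosetRep J d⁻¹) (hw : w ∈ parabolic J) :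
    structConst d⁻¹ d w = if w = 1 then 1 else 0 := by
  have hmul : T d * T w = T (d * w) := by simpa only [inv_inv] using hd.T_inv_mul_T hw
  simp only [structConst_eq_toDual, inv_inv, hmul, toDual_T_T, left_eq_mul]

/-! ### Combinations with coefficients in `ℕ[ξ]` -/

section NatSpan

/-- The combinations of the `T_w`, `w ∈ A`, with coefficients in `ℕ[ξ]`, the latter being encoded
as the subsemiring `natPoly.rangeS` of `ℤ[ξ]`. -/
noncomputable def natSpan (A : Set (Equiv.Perm (Fin n))) :
    Submodule natPoly.rangeS (HeckeAlgebra n) :=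
  Submodule.span natPoly.rangeS (T '' A)

variable {A : Set (Equiv.Perm (Fin n))} {a : HeckeAlgebra n}

theorem T_mem_natSpan {w : Equiv.Perm (Fin n)} (hw : w ∈ A) : T w ∈ natSpan A :=
  Submodule.subset_span ⟨w, hw, rfl⟩

theorem repr_T (u w : Equiv.Perm (Fin n)) :
    (basisT n).repr (T u) w = if u = w then 1 else 0 := by
  classical
  rw [← basisT_apply, Module.Basis.repr_self, Finsupp.single_apply]

theorem repr_of_mem_natSpan (ha : a ∈ natSpan A) (w : Equiv.Perm (Fin n)) :
    (basisT n).repr a w ∈ natPoly.rangeS ∧ (w ∉ A → (basisT n).repr a w = 0) := by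
  induction ha using Submodule.span_induction with
  | mem x hx =>
    obtain ⟨u, hu, rfl⟩ := hx
    rw [repr_T]
    split_ifs with h
    · exact ⟨one_mem _, fun hw => absurd (h ▸ hu) hw⟩
    · exact ⟨zero_mem _, fun _ => rfl⟩
  | zero => simp
  | add x y _ _ hx hy =>
    rw [map_add, Finsupp.add_apply]
    exact ⟨add_mem hx.1 hy.1, fun hw => by rw [hx.2 hw, hy.2 hw, add_zero]⟩
  | smul c x _ hx =>
    rw [Subsemiring.smul_def, map_smul, Finsupp.smul_apply, smul_eq_mul]
    exact ⟨mul_mem c.2 hx.1, fun hw => by rw [hx.2 hw, mul_zero]⟩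

theorem exists_natPoly_of_mem_natSpan (ha : a ∈ natSpan A) :
    ∃ g : Equiv.Perm (Fin n) → ℕ[X], (∀ w, natPoly (g w) = (basisT n).repr a w) ∧
      a = ∑ w, natPoly (g w) • T w ∧ ∀ w, g w ≠ 0 → w ∈ A := by
  have hrepr := repr_of_mem_natSpan ha
  choose g hg using fun w => (hrepr w).1
  refine ⟨g, hg, ?_, fun w => not_imp_comm.1 fun hw => ?_⟩
  · simp only [hg, ← basisT_apply, (basisT n).sum_repr]
  · have hinj : Function.Injective natPoly := Polynomial.map_injective _ Nat.cast_injective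
    exact hinj (by rw [hg, (hrepr w).2 hw, map_zero])

theorem gen_mul_mem_natSpan {i : Idx n} (hA : ∀ w ∈ A, simple i * w ∈ A) (ha : a ∈ natSpan A) :
    gen i * a ∈ natSpan A := by
  induction ha using Submodule.span_induction with
  | mem x hx =>
    obtain ⟨w, hw, rfl⟩ := hx
    by_cases h : Asc i w
    · rw [gen_mul_T_of_asc h]
      exact T_mem_natSpan (hA w hw)
    · have hX : (X : ℤ[X]) ∈ natPoly.rangeS := ⟨X, by simp [natPoly]⟩
      rw [gen_mul_T_of_not_asc h]
      exact add_mem (T_mem_natSpan (hA w hw)) ((natSpan A).smul_mem ⟨X, hX⟩ (T_mem_natSpan hw))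
  | zero => simp
  | add x y _ _ hx hy =>
    rw [mul_add]
    exact add_mem hx hy
  | smul c x _ hx =>
    rw [Subsemiring.smul_def, mul_smul_comm]
    exact (natSpan A).smul_mem c hx

theorem T_wordProd_mul_mem_natSpan {l : List (Idx n)} (hl : IsReduced l)
    (hA : ∀ i ∈ l, ∀ w ∈ A, simple i * w ∈ A) (ha : a ∈ natSpan A) :
    T (wordProd l) * a ∈ natSpan A := by
  rw [hl.T_wordProd]
  clear hl
  induction l with
  | nil => simpa using ha
  | cons i l ih =>
    obtain ⟨hi, hl⟩ := List.forall_mem_cons.1 hA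
    rw [List.map_cons, List.prod_cons, mul_assoc]
    exact gen_mul_mem_natSpan hi (ih hl)

theorem T_mul_T_mem_natSpan_univ (x y : Equiv.Perm (Fin n)) : T x * T y ∈ natSpan Set.univ := by
  obtain ⟨l, hl, rfl⟩ := exists_reduced x
  exact T_wordProd_mul_mem_natSpan hl (fun _ _ _ _ => Set.mem_univ _)
    (T_mem_natSpan (Set.mem_univ y))

theorem T_mul_mem_natSpan_compl_parabolic {J : Set (Idx n)} {v : Equiv.Perm (Fin n)}
    (hv : v ∈ parabolic J) (ha : a ∈ natSpan (parabolic J : Set (Equiv.Perm (Fin n)))ᶜ) :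
    T v * a ∈ natSpan (parabolic J : Set (Equiv.Perm (Fin n)))ᶜ := by
  obtain ⟨l, hl, rfl, hlJ⟩ := exists_reduced_of_mem_parabolic hv
  refine T_wordProd_mul_mem_natSpan hl (fun i hi w hw hiw => hw ?_) ha
  exact (Subgroup.mul_mem_cancel_left _ (simple_mem_parabolic (hlJ i hi))).1 hiw

end NatSpan

/-! ### Products with minimal coset representatives -/

namespace IsMinCosetRep

variable {J K : Set (Idx n)} {d v : Equiv.Perm (Fin n)}

theorem exists_T_inv_mul_T_self_eq (hd : IsMinCosetRep J d⁻¹) :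
    ∃ a ∈ natSpan (parabolic J : Set (Equiv.Perm (Fin n)))ᶜ, T d⁻¹ * T d = T 1 + a := by
  refine ⟨∑ w ∈ Finset.univ.erase 1, structConst d⁻¹ d w • T w, sum_mem fun w hw => ?_, ?_⟩
  · by_cases hwJ : w ∈ parabolic J
    · rw [hd.structConst_inv_self hwJ, if_neg (Finset.ne_of_mem_erase hw), zero_smul]
      exact zero_mem _
    · have hcoeff := (repr_of_mem_natSpan (T_mul_T_mem_natSpan_univ d⁻¹ d) w).1
      exact (natSpan _).smul_mem ⟨_, hcoeff⟩ (T_mem_natSpan hwJ)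
  · have hexpand : ∑ w, structConst d⁻¹ d w • T w = T d⁻¹ * T d := by
      simp only [structConst, ← basisT_apply, (basisT n).sum_repr]
    rw [← hexpand, ← Finset.add_sum_erase _ _ (Finset.mem_univ 1),
      hd.structConst_inv_self (one_mem _), if_pos rfl, one_smul]

theorem T_inv_mul_T_mul_T (hJ : IsMinCosetRep J d⁻¹) (hK : IsMinCosetRep K d)
    (hv : v ∈ parabolic K) (hdv : d⁻¹ * v * d ∈ parabolic J) :
    T d⁻¹ * T v * T d = T (d⁻¹ * v * d) * (T d⁻¹ * T d) := by
  rw [← mul_assoc, hJ.T_mul_T hdv, mul_inv_cancel_right, hK.T_inv_mul_T hv]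

end IsMinCosetRep

/-! ### The elements `d_m` -/

section DElt

theorem swap_val (a b x : Fin n) :
    (Equiv.swap a b x).1 = if x.1 = a.1 then b.1 else if x.1 = b.1 then a.1 else x.1 := by
  simp only [Equiv.swap_apply_def, Fin.ext_iff]
  split_ifs <;> rfl

variable (k : Idx n) (m : ℕ)

theorem prod_ofFn_swap_val (hm : m ≤ min k.1 (n - k.1)) (r : ℕ) (hr : r ≤ m) (x : Fin n) :
    ((List.ofFn fun j : Fin r =>
      Equiv.swap (letter (k.1 - j.1) (by omega) : Fin n)
        (letter (k.1 + m - j.1) (by omega))).prod x).1 =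
      if k.1 ≤ x.1 + r ∧ x.1 < k.1 then x.1 + m
      else if k.1 + m ≤ x.1 + r ∧ x.1 < k.1 + m then x.1 - m else x.1 := by
  induction r generalizing x with
  | zero =>
    rw [List.ofFn_zero, List.prod_nil, Equiv.Perm.one_apply]
    split_ifs <;> omega
  | succ r ih =>
    rw [List.ofFn_succ', List.concat_eq_append, List.prod_append, List.prod_singleton,
      Equiv.Perm.mul_apply]
    simp only [Fin.val_castSucc, Fin.val_last]
    rw [ih (by omega)]
    have hy : (Equiv.swap (letter (k.1 - r) (by omega) : Fin n)
        (letter (k.1 + m - r) (by omega)) x).1 =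
        if x.1 = k.1 - r - 1 then k.1 + m - r - 1
        else if x.1 = k.1 + m - r - 1 then k.1 - r - 1 else x.1 := swap_val _ _ x
    generalize Equiv.swap _ _ x = y at hy ⊢
    have := k.2
    clear ih
    split_ifs at hy <;> split_ifs <;> omega

variable (hm : m ≤ min k.1 (n - k.1))

theorem dElt_val (x : Fin n) :
    (dElt k m hm x).1 =
      if k.1 ≤ x.1 + m ∧ x.1 < k.1 then x.1 + m
      else if k.1 ≤ x.1 ∧ x.1 < k.1 + m then x.1 - m else x.1 := by
  rw [dElt, prod_ofFn_swap_val k m hm m le_rfl]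
  simp only [Nat.add_le_add_iff_right]

theorem dElt_inv : (dElt k m hm)⁻¹ = dElt k m hm := by
  refine inv_eq_of_mul_eq_one_right (Equiv.ext fun x => Fin.ext ?_)
  rw [Equiv.Perm.mul_apply, dElt_val, dElt_val, Equiv.Perm.one_apply]
  split_ifs <;> omega

theorem isMinCosetRep_dElt : IsMinCosetRep {i | i ≠ k} (dElt k m hm) := by
  intro i hi
  have hik : i.1 ≠ k.1 := fun h => hi (Subtype.ext h)
  have := i.2.1
  simp only [Asc, dElt_inv, Fin.lt_def, dElt_val, letter]
  split_ifs <;> omega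

theorem mem_P_iff {v : Equiv.Perm (Fin n)} : v ∈ P k m hm ↔
    v ∈ parabolic {i | i ≠ k} ∧ dElt k m hm * v * dElt k m hm ∈ parabolic {i | i ≠ k} := by
  rw [P, dElt_inv, Subgroup.mem_inf, Subgroup.mem_map_equiv, MulAut.conj_symm_apply, dElt_inv]
  rfl

end DElt

end HeckeSym

theorem mainTheorem8_general {n : ℕ} {J K : Set (HeckeSym.Idx n)} {d : Equiv.Perm (Fin n)}
    (hJ : HeckeSym.IsMinCosetRep J d⁻¹) (hK : HeckeSym.IsMinCosetRep K d) :
    (∃ f : Equiv.Perm (Fin n) → Polynomial ℕ,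
      (∀ w, w ≠ 1 → HeckeSym.natPoly (f w) = HeckeSym.structConst d⁻¹ d w) ∧
      HeckeSym.T d⁻¹ * HeckeSym.T d =
        HeckeSym.T 1 + ∑ w, HeckeSym.natPoly (f w) • HeckeSym.T w ∧
      ∀ w, f w ≠ 0 → w ∉ HeckeSym.parabolic J) ∧
    ∀ v ∈ HeckeSym.parabolic K, d⁻¹ * v * d ∈ HeckeSym.parabolic J →
      ∃ g : Equiv.Perm (Fin n) → Polynomial ℕ,
        HeckeSym.T d⁻¹ * HeckeSym.T v * HeckeSym.T d =
          HeckeSym.T (d⁻¹ * v * d) + ∑ w, HeckeSym.natPoly (g w) • HeckeSym.T w ∧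
        ∀ w, g w ≠ 0 → w ∉ HeckeSym.parabolic J := by
  obtain ⟨a, ha, heq⟩ := hJ.exists_T_inv_mul_T_self_eq
  constructor
  · obtain ⟨f, hcoeff, hsum, hsupp⟩ := HeckeSym.exists_natPoly_of_mem_natSpan ha
    refine ⟨f, fun w hw => ?_, by rw [heq, ← hsum], hsupp⟩
    rw [hcoeff, HeckeSym.structConst, heq, map_add, Finsupp.add_apply, HeckeSym.repr_T,
      if_neg hw.symm, zero_add]
  · intro v hv hdv
    obtain ⟨g, -, hsum, hsupp⟩ := HeckeSym.exists_natPoly_of_mem_natSpan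
      (HeckeSym.T_mul_mem_natSpan_compl_parabolic hdv ha)
    refine ⟨g, ?_, hsupp⟩
    rw [← hsum, hJ.T_inv_mul_T_mul_T hK hv hdv, heq, mul_add, HeckeSym.T_one, mul_one]

theorem mainTheorem8 (n : ℕ) (k : HeckeSym.Idx n) (m : ℕ) (hm : m ≤ min k.1 (n - k.1)) :
    (∃ f : Equiv.Perm (Fin n) → Polynomial ℕ,
      (∀ w, w ≠ 1 → HeckeSym.natPoly (f w) =
        HeckeSym.structConst (HeckeSym.dElt k m hm) (HeckeSym.dElt k m hm) w) ∧
      (HeckeSym.T (HeckeSym.dElt k m hm)) ^ 2 =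
        HeckeSym.T 1 + ∑ w, HeckeSym.natPoly (f w) • HeckeSym.T w ∧
      ∀ w, f w ≠ 0 → 1 ≤ HeckeSym.hash k w) ∧
    ∀ v ∈ HeckeSym.P k m hm, ∃ g : Equiv.Perm (Fin n) → Polynomial ℕ,
      HeckeSym.T (HeckeSym.dElt k m hm) * HeckeSym.T v * HeckeSym.T (HeckeSym.dElt k m hm) =
        HeckeSym.T (HeckeSym.dElt k m hm * v * HeckeSym.dElt k m hm) +
          ∑ w, HeckeSym.natPoly (g w) • HeckeSym.T w ∧
      ∀ w, g w ≠ 0 → 1 ≤ HeckeSym.hash k w := by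
  have hd := HeckeSym.isMinCosetRep_dElt k m hm
  have hgen := mainTheorem8_general (HeckeSym.dElt_inv k m hm ▸ hd) hd
  simpa only [HeckeSym.dElt_inv, HeckeSym.mem_P_iff, and_imp, sq, Nat.one_le_iff_ne_zero, ne_eq,
    HeckeSym.hash_eq_zero_iff] using hgen
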